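/- Let $\mathcal T=\{0,\dots,T\}$, let $L$ be the number of goods and let $\Lambda\subseteq\mathbb R_{++}^{|\mathcal T|}$, $\Delta\subseteq(0,1]^{|\mathcal T|}$. Let $\mathbf x=(\boldsymbol\rho_t,\mathbf c_t)_{t\in\mathcal T}$ be the observed random array of effective prices and consumption bundles in $\mathbb R^L$, with distribution $\pi_0$. A latent vector is $e=(\lambda,\delta,v,w)$ with $\lambda,\delta,v\in\mathbb R^{|\mathcal T|}$ and measurement errors $w_t=(w^c_t,w^p_t)$. For each $x$ let $E_x$ be the known support of the latent vector given $\mathbf x=x$: a set of latent vectors with $\lambda\in\Lambda$, $\delta\in\Delta$, $v\ge0$, $\rho_t-w^p_t\in\mathbb R^L_{++}$ and $c_t-w^c_t\in\mathbb R^L_+\setminus\{0\}$ for all $t$, such that $\{(x,e):e\in E_x\}$ is measurable. Let $g_M(x,e)\in\mathbb R^{q}$ be a measurable measurement error moment. For $t,s\in\mathcal T$ consider the revealed preference inequality $$ (\mathrm{RP}_{t,s})\qquad v_t-v_s\ \ge\ \frac{\lambda_t}{\delta_t}(\rho_t-w^p_t)'\big[(c_t-w^c_t)-(c_s-w^c_s)\big],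 $$ and put $g_{I,t,s}(x,e)=\mathbf 1\{\mathrm{RP}_{t,s}\text{ holds}\}-1$ for $t\ne s$ and $g=(g_I',g_M')'\in\mathbb R^{k+q}$, $k=|\mathcal T|^2-|\mathcal T|$. Say that $\mathbf x$ is approximately $\mathrm s/\mathrm m$-rationalizable with centered measurement error if, on some probability space carrying an array $\mathbf x$ with distribution $\pi_0$, there are latent random vectors $\mathbf e_j$, $j=1,2,\dots$, with $\mathbf e_j\in E_{\mathbf x}$ almost surely, such that, as $j\to\infty$, $\mathbb P\{(\mathrm{RP}_{t,s})\text{ holds at }(\mathbf x,\mathbf e_j)\}\to1$ for all $t,s\in\mathcal T$, and $\mathbb E[g_M(\mathbf x,\mathbf e_j)]$ exists for every $j$ and tends to $0$. Let $\eta(\cdot|x)$ be a conditional probability distribution of $e$ given $x$ that is supported on $E_x$ in the following sense: for $\pi_0$-almost every $x$, $\eta(E_x|x)=1$ and $\eta(\{e\in E_x:\|g(x,e)-g(x,e_0)\|<\varepsilon\}|x)>0$ for all $e_0\in E_x$, $\varepsilon>0$. Suppose that $\gamma\mapsto\mathbb E_{\pi_0}\big[\log\int\exp(\gamma'g(\mathbf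 x,e))\,d\eta(e|\mathbf x)\big]$ exists (is finite) and is twice continuously differentiable on $\mathbb R^{k+q}$, and define the maximum-entropy moment $$h(x;\gamma)=\frac{\int g(x,e)\exp(\gamma'g(x,e))\,d\eta(e|x)}{\int \exp(\gamma'g(x,e))\,d\eta(e|x)}.$$ Theorem. The following are equivalent: (i) $\mathbf x$ is approximately $\mathrm s/\mathrm m$-rationalizable with centered measurement error; (ii) $\displaystyle\inf_{\gamma\in\mathbb R^{k+q}}\big\|\mathbb E_{\pi_0}[h(\mathbf x;\gamma)]\big\|=0$. -/

import Mathlib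

open MeasureTheory ProbabilityTheory Filter Topology

noncomputable section

namespace RevealedPreference

/-- Observed arrays `x = (ρ_t, c_t)` indexed by `t ∈ {0, …, T}`, with `L` commodities:
`(x t).1` is the effective price vector `ρ_t` and `(x t).2` is the consumption bundle `c_t`. -/
abbrev Obs (T L : ℕ) : Type := Fin (T + 1) → (Fin L → ℝ) × (Fin L → ℝ)

/-- Latent vectors `e = (λ, δ, v, w)`; the measurement error `w_t` is a pair
(price error `w_t^p`, consumption error `w_t^c`), in the same order as in `Obs`. -/
abbrev Latent (T L : ℕ) : Type :=
  (Fin (T + 1) → ℝ) × (Fin (T + 1) → ℝ) × (Fin (T + 1) → ℝ) × Obs T L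

variable {T L q : ℕ}

/-- Marginal utilities of income `λ_t`. -/
def lam (e : Latent T L) (t : Fin (T + 1)) : ℝ := e.1 t

/-- Discount rates `δ_t`. -/
def del (e : Latent T L) (t : Fin (T + 1)) : ℝ := e.2.1 t

/-- Utility numbers `v_t`. -/
def util (e : Latent T L) (t : Fin (T + 1)) : ℝ := e.2.2.1 t

/-- True effective prices `ρ*_t = ρ_t - w_t^p`. -/
def truePrice (x : Obs T L) (e : Latent T L) (t : Fin (T + 1)) : Fin L → ℝ :=
  (x t).1 - (e.2.2.2 t).1

/-- True consumption `c*_t = c_t - w_t^c`. -/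
def trueCons (x : Obs T L) (e : Latent T L) (t : Fin (T + 1)) : Fin L → ℝ :=
  (x t).2 - (e.2.2.2 t).2

/-- The largest possible conditional support of the latent vector for a model with supports
`Λ` and `Δ`: `λ ∈ Λ`, `δ ∈ Δ`, `v ≥ 0`, true prices positive, true consumption nonnegative and
nonzero. Any further restriction makes the support smaller. -/
def admissible (Λ Δ : Set (Fin (T + 1) → ℝ)) (x : Obs T L) : Set (Latent T L) :=
  {e | lam e ∈ Λ ∧ del e ∈ Δ ∧ (∀ t, 0 ≤ util e t) ∧
    (∀ t l, 0 < truePrice x e t l) ∧ (∀ t, (∀ l, 0 ≤ trueCons x e t l) ∧ trueCons x e t ≠ 0)}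

/-- Slack of the revealed preference inequality:
`v_t - v_s - (λ_t / δ_t) ρ*_t ⬝ (c*_t - c*_s)`. -/
def slack (x : Obs T L) (e : Latent T L) (t s : Fin (T + 1)) : ℝ :=
  util e t - util e s -
    lam e t / del e t * ∑ l, truePrice x e t l * (trueCons x e t l - trueCons x e s l)

/-- The observed array with law `π₀` is approximately rationalizable with centered measurement
error: on some probability space carrying an array `x` with law `π₀` there is a sequence of latent
random vectors `e_j`, supported on or inside the known support `E`, along which every revealed
preference inequality holds with probability tending to `1` and the expectation of the
measurement error moment exists and tends to `0`. -/
def ApproxRationalizable (E : Obs T L → Set (Latent T L))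
    (gM : Obs T L → Latent T L → EuclideanSpace ℝ (Fin q)) (π₀ : Measure (Obs T L)) : Prop :=
  ∃ (Ω : Type) (_ : MeasurableSpace Ω) (P : Measure Ω) (x : Ω → Obs T L)
    (e : ℕ → Ω → Latent T L),
    IsProbabilityMeasure P ∧ Measurable x ∧ P.map x = π₀ ∧ (∀ j, Measurable (e j)) ∧
    (∀ j, ∀ᵐ ω ∂P, e j ω ∈ E (x ω)) ∧
    (∀ t s, Tendsto (fun j => P {ω | 0 ≤ slack (x ω) (e j ω) t s}) atTop (𝓝 1)) ∧
    (∀ j, Integrable (fun ω => gM (x ω) (e j ω)) P) ∧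
    Tendsto (fun j => ∫ ω, gM (x ω) (e j ω) ∂P) atTop (𝓝 0)

/-- Index set of the moments: the ordered pairs `t ≠ s` (there are `k = (T+1)² - (T+1)` of them),
followed by the `q` measurement error moments. -/
abbrev MomentIdx (T q : ℕ) : Type :=
  {p : Fin (T + 1) × Fin (T + 1) // p.1 ≠ p.2} ⊕ Fin q

/-- The moment function `g = (g_I, g_M)`, where `g_{I,t,s}` is the indicator of the revealed
preference inequality minus one. -/
def moment (gM : Obs T L → Latent T L → EuclideanSpace ℝ (Fin q)) (x : Obs T L)
    (e : Latent T L) : EuclideanSpace ℝ (MomentIdx T q) :=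
  WithLp.toLp 2 (Sum.elim
    (fun p => (if 0 ≤ slack x e p.1.1 p.1.2 then (1 : ℝ) else 0) - 1)
    (fun i => gM x e i))

/-- `∫ exp(γ'g(x,e)) dη(e|x)`. -/
def expMass (gM : Obs T L → Latent T L → EuclideanSpace ℝ (Fin q))
    (η : Kernel (Obs T L) (Latent T L)) (γ : EuclideanSpace ℝ (MomentIdx T q))
    (x : Obs T L) : ℝ :=
  ∫ e, Real.exp (inner ℝ γ (moment gM x e)) ∂(η x)

/-- The maximum-entropy moment
`h(x;γ) = ∫ g(x,e) exp(γ'g(x,e)) dη(e|x) / ∫ exp(γ'g(x,e)) dη(e|x)`. -/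
def maxEntMoment (gM : Obs T L → Latent T L → EuclideanSpace ℝ (Fin q))
    (η : Kernel (Obs T L) (Latent T L)) (x : Obs T L)
    (γ : EuclideanSpace ℝ (MomentIdx T q)) : EuclideanSpace ℝ (MomentIdx T q) :=
  (expMass gM η γ x)⁻¹ •
    ∫ e, Real.exp (inner ℝ γ (moment gM x e)) • moment gM x e ∂(η x)

/-- `η` is supported on `E`, for the purposes of the moment function `g`: for almost every `x`,
`η(·|x)` is concentrated on `E x`, and it misses no part of `E x` that `g(x,·)` can see, i.e. for
every `e₀ ∈ E x` the points `e ∈ E x` whose moments are close to those of `e₀` have positive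
mass. If `g(x,·)` is continuous on `E x`, the latter follows from `E x` lying in the topological
support of `η(·|x)`. -/
def SupportedOn (E : Obs T L → Set (Latent T L))
    (gM : Obs T L → Latent T L → EuclideanSpace ℝ (Fin q)) (π₀ : Measure (Obs T L))
    (η : Kernel (Obs T L) (Latent T L)) : Prop :=
  ∀ᵐ x ∂π₀, (∀ᵐ e ∂(η x), e ∈ E x) ∧
    ∀ e₀ ∈ E x, ∀ ε > 0, 0 < η x {e | e ∈ E x ∧ ‖moment gM x e - moment gM x e₀‖ < ε}

/-- `γ ↦ E_{π₀}[log E_η[exp(γ'g(x,e)) | x]]` exists (as a finite number) for all `γ` and is twice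
continuously differentiable. -/
def RegularLogMass (gM : Obs T L → Latent T L → EuclideanSpace ℝ (Fin q))
    (π₀ : Measure (Obs T L)) (η : Kernel (Obs T L) (Latent T L)) : Prop :=
  (∀ γ, (∀ᵐ x ∂π₀, Integrable (fun e => Real.exp (inner ℝ γ (moment gM x e))) (η x)) ∧
    Integrable (fun x => Real.log (expMass gM η γ x)) π₀) ∧
  ContDiff ℝ 2 (fun γ => ∫ x, Real.log (expMass gM η γ x) ∂π₀)

end RevealedPreference

end

/-!
Write `Φ γ = 𝔼 log ∫ exp(γ'g) dη`. The maximum-entropy moment `h(x;γ)` is the mean of `g` under the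
exponentially tilted law `dη_γ ∝ exp(γ'g) dη`, so by Jensen's inequality
`log ∫ exp(γ'g) dη` lies above its supporting hyperplane with slope `h(x;γ)`, and `𝔼 h(x;γ)` is a
subgradient of `Φ` at `γ` (`integral_log_expMass_add_inner_le`). Everything needs first moments of
`g` under `π₀ ⊗ η_γ`, although only log masses are assumed integrable; they exist because
`𝔼|f| ≤ log 𝔼 exp|f|` bounds them by increments of the log mass (`integral_abs_tilted_le`).

If `𝔼 h(x;γ_j) → 0` along some sequence, latent vectors drawn from `η_{γ_j}` rationalize the data.
They all live on `π₀ × [0,1]`, since a Markov kernel into a standard Borel space is the image of the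
uniform law under a jointly measurable map (`exists_random_latent`).

Conversely, let a latent vector supported in `E` have expected moment `m`. Because `η` charges every
neighbourhood of its moments, `Φ γ ≥ γ'm - 2ε‖γ‖ - C` for every `ε > 0` and some `C`
(`exists_lower_bound_of_random_latent`). When `m` is small, `Φ` thus falls at most linearly with a
small rate `c`; for `c' > c` the function `Φ + c'‖·‖` is coercive, and at its minimizer the gradient
`𝔼 h(x;γ)` of `Φ` has norm at most `c'` (`exists_norm_subgradient_le`).
-/

namespace RevealedPreference

/-! ### Log-integrals of exponentials and tilted measures -/

section LogIntegral

variable {α ι : Type*} [MeasurableSpace α] [Fintype ι] {ν : Measure α}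

lemma integral_le_log_integral_exp [IsProbabilityMeasure ν] {f : α → ℝ} (hf : Integrable f ν)
    (hexp : Integrable (fun a => Real.exp (f a)) ν) :
    ∫ a, f a ∂ν ≤ Real.log (∫ a, Real.exp (f a) ∂ν) := by
  have h := convexOn_exp.map_integral_le Real.continuous_exp.continuousOn isClosed_univ
    (by simp) hf hexp
  exact (Real.le_log_iff_exp_le (integral_exp_pos hexp)).2 h

lemma integrable_exp_tilted {φ f : α → ℝ} (hφ : Integrable (fun a => Real.exp (φ a)) ν)
    (hf : Integrable (fun a => Real.exp (φ a + f a)) ν) :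
    Integrable (fun a => Real.exp (f a)) (ν.tilted φ) := by
  rw [integrable_tilted_iff hφ]
  simpa only [smul_eq_mul, ← Real.exp_add] using hf

/-- The cumulant generating function lies above its supporting hyperplanes, whose slopes are the
means of the tilted measures. -/
lemma log_integral_exp_add_inner_le [IsProbabilityMeasure ν]
    {g : α → EuclideanSpace ℝ ι} {γ γ' : EuclideanSpace ℝ ι}
    (hγ : Integrable (fun a => Real.exp (inner ℝ γ (g a))) ν)
    (hγ' : Integrable (fun a => Real.exp (inner ℝ γ' (g a))) ν)
    (hg : Integrable g (ν.tilted fun a => inner ℝ γ (g a))) :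
    Real.log (∫ a, Real.exp (inner ℝ γ (g a)) ∂ν) +
        inner ℝ (γ' - γ) (∫ a, g a ∂(ν.tilted fun a => inner ℝ γ (g a))) ≤
      Real.log (∫ a, Real.exp (inner ℝ γ' (g a)) ∂ν) := by
  have : IsProbabilityMeasure (ν.tilted fun a => inner ℝ γ (g a)) :=
    isProbabilityMeasure_tilted hγ
  have hsum : ∀ a, inner ℝ γ (g a) + inner ℝ (γ' - γ) (g a) = inner ℝ γ' (g a) := by
    intro a
    rw [← inner_add_left, add_sub_cancel]
  have h := integral_le_log_integral_exp (hg.const_inner (γ' - γ))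
    (integrable_exp_tilted hγ (by simpa only [hsum] using hγ'))
  rw [integral_inner hg, integral_exp_tilted] at h
  simp only [Pi.add_apply, hsum] at h
  rw [Real.log_div (integral_exp_pos hγ').ne' (integral_exp_pos hγ).ne'] at h
  linarith

lemma log_add_le_log_two_add_abs {a b : ℝ} (ha : 0 < a) (hb : 0 < b) :
    Real.log (a + b) ≤ Real.log 2 + |Real.log a| + |Real.log b| := by
  have key : ∀ {u v : ℝ}, 0 < u → 0 < v → u ≤ v →
      Real.log (u + v) ≤ Real.log 2 + |Real.log v| := by
    intro u v hu hv huv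
    calc Real.log (u + v) ≤ Real.log (2 * v) := Real.log_le_log (by positivity) (by linarith)
      _ = Real.log 2 + Real.log v := Real.log_mul two_ne_zero hv.ne'
      _ ≤ _ := by gcongr; exact le_abs_self _
  rcases le_total a b with h | h
  · linarith [key ha hb h, abs_nonneg (Real.log a)]
  · rw [add_comm]
    linarith [key hb ha h, abs_nonneg (Real.log b)]

lemma abs_le_exp_add_exp_neg (y : ℝ) : |y| ≤ Real.exp y + Real.exp (-y) := by
  rcases abs_cases y with ⟨h, -⟩ | ⟨h, -⟩ <;> rw [h]
  · linarith [Real.add_one_le_exp y, Real.exp_pos (-y)]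
  · linarith [Real.add_one_le_exp (-y), Real.exp_pos y]

/-- First absolute moments under a tilted measure are controlled by increments of the *logarithm*
of the exponential mass: Jensen gives `𝔼|f| ≤ log 𝔼 exp|f|`, and `exp|f| ≤ exp f + exp(-f)`. -/
lemma integral_abs_tilted_le [IsProbabilityMeasure ν] {φ f : α → ℝ}
    (hφ : Integrable (fun a => Real.exp (φ a)) ν)
    (hf : AEStronglyMeasurable f ν)
    (hadd : Integrable (fun a => Real.exp (φ a + f a)) ν)
    (hsub : Integrable (fun a => Real.exp (φ a + -f a)) ν) :
    Integrable f (ν.tilted φ) ∧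
      ∫ a, |f a| ∂(ν.tilted φ) ≤ Real.log 2 +
        |Real.log (∫ a, Real.exp (φ a + f a) ∂ν) - Real.log (∫ a, Real.exp (φ a) ∂ν)| +
        |Real.log (∫ a, Real.exp (φ a + -f a) ∂ν) - Real.log (∫ a, Real.exp (φ a) ∂ν)| := by
  have : IsProbabilityMeasure (ν.tilted φ) := isProbabilityMeasure_tilted hφ
  have hp := integrable_exp_tilted hφ hadd
  have hn := integrable_exp_tilted hφ hsub
  have hft : AEStronglyMeasurable f (ν.tilted φ) := hf.mono_ac (tilted_absolutelyContinuous ν φ)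
  have hfi : Integrable f (ν.tilted φ) := by
    refine (hp.add hn).mono' hft (ae_of_all _ fun a => ?_)
    exact abs_le_exp_add_exp_neg (f a)
  have hexp_le : ∀ a, Real.exp |f a| ≤ Real.exp (f a) + Real.exp (-f a) := by
    intro a
    rcases abs_cases (f a) with ⟨h, -⟩ | ⟨h, -⟩ <;> rw [h] <;>
      linarith [Real.exp_pos (f a), Real.exp_pos (-f a)]
  have hexp : Integrable (fun a => Real.exp |f a|) (ν.tilted φ) := by
    refine (hp.add hn).mono' (Real.continuous_exp.comp_aestronglyMeasurable hft.norm)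
      (ae_of_all _ fun a => ?_)
    rw [Real.norm_of_nonneg (Real.exp_pos _).le]
    exact hexp_le a
  refine ⟨hfi, ?_⟩
  have hlog : ∀ {u : α → ℝ}, Integrable (fun a => Real.exp (φ a + u a)) ν →
      Real.log (∫ a, Real.exp (u a) ∂(ν.tilted φ)) =
        Real.log (∫ a, Real.exp (φ a + u a) ∂ν) - Real.log (∫ a, Real.exp (φ a) ∂ν) := by
    intro u hu
    rw [integral_exp_tilted]
    exact Real.log_div (integral_exp_pos hu).ne' (integral_exp_pos hφ).ne'
  calc ∫ a, |f a| ∂(ν.tilted φ)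
      ≤ Real.log (∫ a, Real.exp |f a| ∂(ν.tilted φ)) :=
        integral_le_log_integral_exp hfi.abs hexp
    _ ≤ Real.log (∫ a, Real.exp (f a) ∂(ν.tilted φ) + ∫ a, Real.exp (-f a) ∂(ν.tilted φ)) := by
        refine Real.log_le_log (integral_exp_pos hexp) ?_
        rw [← integral_add hp hn]
        exact integral_mono hexp (hp.add hn) hexp_le
    _ ≤ _ := by
        have h := log_add_le_log_two_add_abs (integral_exp_pos hp) (integral_exp_pos hn)
        rwa [hlog hadd, hlog hsub] at h

lemma euclidean_norm_le_sum_abs (y : EuclideanSpace ℝ ι) : ‖y‖ ≤ ∑ i, |y i| := by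
  classical
  calc ‖y‖ = ‖∑ i, y i • EuclideanSpace.basisFun ι ℝ i‖ := by
        congr 1
        exact ((EuclideanSpace.basisFun ι ℝ).sum_repr y).symm
    _ ≤ ∑ i, ‖y i • EuclideanSpace.basisFun ι ℝ i‖ := norm_sum_le _ _
    _ = ∑ i, |y i| := by simp [norm_smul]

/-- Vector version of `integral_abs_tilted_le`, by summing over the coordinates. -/
lemma integral_norm_tilted_le [IsProbabilityMeasure ν] [DecidableEq ι] {g : α → EuclideanSpace ℝ ι}
    (hg : Measurable g) {γ : EuclideanSpace ℝ ι}
    (hγ : Integrable (fun a => Real.exp (inner ℝ γ (g a))) ν)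
    (hadd : ∀ i, Integrable
      (fun a => Real.exp (inner ℝ (γ + EuclideanSpace.single i 1) (g a))) ν)
    (hsub : ∀ i, Integrable
      (fun a => Real.exp (inner ℝ (γ - EuclideanSpace.single i 1) (g a))) ν) :
    Integrable g (ν.tilted fun a => inner ℝ γ (g a)) ∧
      ∫ a, ‖g a‖ ∂(ν.tilted fun a => inner ℝ γ (g a)) ≤ ∑ i, (Real.log 2 +
        |Real.log (∫ a, Real.exp (inner ℝ (γ + EuclideanSpace.single i 1) (g a)) ∂ν) -
          Real.log (∫ a, Real.exp (inner ℝ γ (g a)) ∂ν)| +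
        |Real.log (∫ a, Real.exp (inner ℝ (γ - EuclideanSpace.single i 1) (g a)) ∂ν) -
          Real.log (∫ a, Real.exp (inner ℝ γ (g a)) ∂ν)|) := by
  have hpos : ∀ i a, inner ℝ (γ + EuclideanSpace.single i 1) (g a) =
      inner ℝ γ (g a) + g a i := by
    intro i a
    simp [inner_add_left, EuclideanSpace.inner_single_left]
  have hneg : ∀ i a, inner ℝ (γ - EuclideanSpace.single i 1) (g a) =
      inner ℝ γ (g a) + -g a i := by
    intro i a
    rw [inner_sub_left, EuclideanSpace.inner_single_left]
    simp [sub_eq_add_neg]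
  simp only [hpos, hneg] at hadd hsub ⊢
  have hcoord := fun i => integral_abs_tilted_le hγ
    (f := fun a => g a i) (by fun_prop : Measurable fun a => g a i).aestronglyMeasurable
    (hadd i) (hsub i)
  have hgi : Integrable g (ν.tilted fun a => inner ℝ γ (g a)) :=
    Integrable.of_eval_piLp fun i => (hcoord i).1
  refine ⟨hgi, ?_⟩
  calc ∫ a, ‖g a‖ ∂(ν.tilted fun a => inner ℝ γ (g a))
      ≤ ∫ a, ∑ i, |g a i| ∂(ν.tilted fun a => inner ℝ γ (g a)) :=
        integral_mono hgi.norm (integrable_finsetSum _ fun i _ => (hcoord i).1.abs)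
          fun a => euclidean_norm_le_sum_abs (g a)
    _ = ∑ i, ∫ a, |g a i| ∂(ν.tilted fun a => inner ℝ γ (g a)) :=
        integral_finsetSum _ fun i _ => (hcoord i).1.abs
    _ ≤ _ := Finset.sum_le_sum fun i _ => (hcoord i).2

/-- An exponential integral is at least the contribution of a ball around `y` of mass at least
`a`. -/
lemma inner_sub_add_log_le_log_integral_exp [IsFiniteMeasure ν] {g : α → EuclideanSpace ℝ ι}
    (hg : Measurable g) {γ y : EuclideanSpace ℝ ι} {ε a : ℝ} (ha : 0 < a)
    (hmass : a ≤ ν.real {b | ‖g b - y‖ < ε})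
    (hγ : Integrable (fun b => Real.exp (inner ℝ γ (g b))) ν) :
    inner ℝ γ y - ε * ‖γ‖ + Real.log a ≤ Real.log (∫ b, Real.exp (inner ℝ γ (g b)) ∂ν) := by
  have hS : MeasurableSet {b | ‖g b - y‖ < ε} :=
    measurableSet_lt (hg.sub_const y).norm measurable_const
  have h : Real.exp (inner ℝ γ y - ε * ‖γ‖) * a ≤ ∫ b, Real.exp (inner ℝ γ (g b)) ∂ν := by
    calc Real.exp (inner ℝ γ y - ε * ‖γ‖) * a
        ≤ Real.exp (inner ℝ γ y - ε * ‖γ‖) * ν.real {b | ‖g b - y‖ < ε} := by gcongr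
      _ = ∫ _ in {b | ‖g b - y‖ < ε}, Real.exp (inner ℝ γ y - ε * ‖γ‖) ∂ν := by
          rw [setIntegral_const, smul_eq_mul, mul_comm]
      _ ≤ ∫ b in {b | ‖g b - y‖ < ε}, Real.exp (inner ℝ γ (g b)) ∂ν := by
          refine setIntegral_mono_on (integrable_const _).integrableOn hγ.integrableOn hS
            fun b hb => ?_
          have h1 := (abs_le.1 (abs_real_inner_le_norm γ (g b - y))).1
          have h2 : ‖γ‖ * ‖g b - y‖ ≤ ‖γ‖ * ε :=
            mul_le_mul_of_nonneg_left (le_of_lt hb) (norm_nonneg γ)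
          rw [inner_sub_right] at h1
          exact Real.exp_le_exp.2 (by linarith)
      _ ≤ ∫ b, Real.exp (inner ℝ γ (g b)) ∂ν :=
          setIntegral_le_integral hγ (ae_of_all _ fun _ => (Real.exp_pos _).le)
  have hlog := Real.log_le_log (by positivity) h
  rwa [Real.log_mul (Real.exp_pos _).ne' ha.ne', Real.log_exp] at hlog

/-- Replacing `Y` by `H` where a positive function `p` is below a threshold changes the integral
of `Y` by an amount that vanishes with the threshold. -/
lemma tendsto_integral_piecewise_of_pos {V : Type*} [NormedAddCommGroup V] [NormedSpace ℝ V]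
    {Y H : α → V} (hY : Integrable Y ν) (hH : Integrable H ν)
    {p : α → ENNReal} (hp : Measurable p) (hpos : ∀ᵐ b ∂ν, 0 < p b)
    [∀ (n : ℕ) b, Decidable (b ∈ {b | ((n : ENNReal) + 1)⁻¹ ≤ p b})] :
    (∀ n : ℕ, Integrable ({b | ((n : ENNReal) + 1)⁻¹ ≤ p b}.piecewise Y H) ν) ∧
    Tendsto (fun n : ℕ => ∫ b, {b | ((n : ENNReal) + 1)⁻¹ ≤ p b}.piecewise Y H b ∂ν) atTop
      (𝓝 (∫ b, Y b ∂ν)) := by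
  have hA : ∀ n : ℕ, MeasurableSet {b | ((n : ENNReal) + 1)⁻¹ ≤ p b} := fun n =>
    measurableSet_le measurable_const hp
  have hint := fun n : ℕ => Integrable.piecewise (hA n) hY.integrableOn hH.integrableOn
  refine ⟨hint, tendsto_integral_of_dominated_convergence (fun b => ‖Y b‖ + ‖H b‖)
    (fun n => (hint n).aestronglyMeasurable) (hY.norm.add hH.norm)
    (fun n => ae_of_all _ fun b => ?_) ?_⟩
  · by_cases h : b ∈ {b | ((n : ENNReal) + 1)⁻¹ ≤ p b}
    · rw [Set.piecewise_eq_of_mem _ _ _ h]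
      linarith [norm_nonneg (H b)]
    · rw [Set.piecewise_eq_of_notMem _ _ _ h]
      linarith [norm_nonneg (Y b)]
  · filter_upwards [hpos] with b hb
    have hlim : Tendsto (fun n : ℕ => ((n : ENNReal) + 1)⁻¹) atTop (𝓝 0) := by
      simpa [Function.comp_def] using
        ENNReal.tendsto_inv_nat_nhds_zero.comp (tendsto_add_atTop_nat 1)
    refine tendsto_const_nhds.congr' ?_
    filter_upwards [hlim.eventually_lt_const hb] with n hn
    exact (Set.piecewise_eq_of_mem {b | ((n : ENNReal) + 1)⁻¹ ≤ p b} _ _ hn.le).symm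

end LogIntegral

/-! ### Approximate stationary points of convex functions -/

/-- A differentiable function on Euclidean space that has a subgradient everywhere and decreases
at most linearly with rate `c` has subgradients of norm at most `c'`, for every `c' > c`: take a
minimizer of `Φ + c'‖·‖`. -/
lemma exists_norm_subgradient_le {V : Type*} [NormedAddCommGroup V] [InnerProductSpace ℝ V]
    [FiniteDimensional ℝ V] {Φ : V → ℝ} {G : V → V} (hΦ : Differentiable ℝ Φ)
    (hG : ∀ γ γ', Φ γ + inner ℝ (γ' - γ) (G γ) ≤ Φ γ') {c c' C : ℝ} (hc₀ : 0 ≤ c)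
    (hc : c < c')
    (hlow : ∀ γ, -(c * ‖γ‖) - C ≤ Φ γ) :
    ∃ γ, ‖G γ‖ ≤ c' := by
  have hcont : Continuous fun γ => Φ γ + c' * ‖γ‖ :=
    hΦ.continuous.add (continuous_const.mul continuous_norm)
  have hcoercive : Tendsto (fun γ => Φ γ + c' * ‖γ‖) (cocompact V) atTop := by
    have h : Tendsto (fun γ : V => (c' - c) * ‖γ‖ + -C) (cocompact V) atTop :=
      tendsto_atTop_add_const_right _ _
        ((tendsto_norm_cocompact_atTop (E := V)).const_mul_atTop (sub_pos.2 hc))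
    refine tendsto_atTop_mono (fun γ => ?_) h
    nlinarith [hlow γ]
  obtain ⟨γ, hγ⟩ := hcont.exists_forall_le hcoercive
  refine ⟨γ, ?_⟩
  set v : V := -G γ with hv
  have hline : HasDerivAt (fun t : ℝ => Φ (γ + t • v)) (fderiv ℝ Φ γ v) 0 := by
    have h1 : HasDerivAt (fun t : ℝ => γ + t • v) v 0 := by
      simpa using ((hasDerivAt_id (0 : ℝ)).smul_const v).const_add γ
    have h2 : HasFDerivAt Φ (fderiv ℝ Φ γ) (γ + (0 : ℝ) • v) := by
      simpa using (hΦ γ).hasFDerivAt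
    exact h2.comp_hasDerivAt 0 h1
  -- a subgradient of a differentiable function is its gradient
  have hgrad : fderiv ℝ Φ γ v = inner ℝ v (G γ) := by
    have hmin : IsLocalMin (fun t : ℝ => Φ (γ + t • v) - t * inner ℝ v (G γ)) 0 := by
      refine Eventually.of_forall fun t => ?_
      have := hG γ (γ + t • v)
      rw [add_sub_cancel_left, inner_smul_left] at this
      simp only [zero_smul, add_zero, zero_mul, sub_zero]
      simp only [conj_trivial] at this
      linarith
    have hder := hline.sub ((hasDerivAt_id (0 : ℝ)).mul_const (inner ℝ v (G γ)))
    have := hmin.hasDerivAt_eq_zero hder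
    linarith
  have hslope : -(c' * ‖v‖) ≤ fderiv ℝ Φ γ v := by
    have ht := (hasDerivAt_iff_tendsto_slope_zero.1 hline).mono_left
      (nhdsWithin_mono (0 : ℝ) (fun t (ht : 0 < t) => ht.ne') : 𝓝[>] (0 : ℝ) ≤ 𝓝[≠] 0)
    refine ge_of_tendsto ht ?_
    filter_upwards [self_mem_nhdsWithin] with t (ht : 0 < t)
    have hmin := hγ (γ + t • v)
    have hnorm : ‖γ + t • v‖ ≤ ‖γ‖ + t * ‖v‖ := by
      simpa [norm_smul, abs_of_pos ht] using norm_add_le γ (t • v)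
    simp only [zero_add, zero_smul, add_zero, smul_eq_mul]
    rw [← div_eq_inv_mul, le_div_iff₀ ht]
    have := mul_le_mul_of_nonneg_left hnorm (hc₀.trans hc.le)
    linarith
  rw [hgrad, hv, inner_neg_left, real_inner_self_eq_norm_sq, norm_neg] at hslope
  by_contra hcon
  push Not at hcon
  have hpos : 0 < ‖G γ‖ := (hc₀.trans_lt hc).trans hcon
  nlinarith [mul_pos hpos (sub_pos.2 hcon)]

/-! ### Measurability of the moments -/

section Moments

variable {T L q : ℕ} {gM : Obs T L → Latent T L → EuclideanSpace ℝ (Fin q)}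

lemma measurable_slack (t s : Fin (T + 1)) :
    Measurable fun p : Obs T L × Latent T L => slack p.1 p.2 t s := by
  unfold slack util lam del truePrice trueCons
  simp only [Pi.sub_apply]
  fun_prop

lemma measurable_moment (hgM : Measurable (Function.uncurry gM)) :
    Measurable fun p : Obs T L × Latent T L => moment gM p.1 p.2 := by
  unfold moment
  refine (WithLp.measurable_toLp 2 _).comp (measurable_pi_lambda _ ?_)
  rintro (p | i)
  · exact (Measurable.ite (measurableSet_le measurable_const (measurable_slack _ _))
      measurable_const measurable_const).sub_const 1
  · have : Measurable fun p : Obs T L × Latent T L => gM p.1 p.2 := hgM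
    simp only [Sum.elim_inr]
    fun_prop

lemma measurable_comp_prodMk {Ω A B C : Type*} [MeasurableSpace Ω] [MeasurableSpace A]
    [MeasurableSpace B] [MeasurableSpace C] {m : A → B → C}
    (hm : Measurable fun p : A × B => m p.1 p.2) {x : Ω → A} {e : Ω → B} (hx : Measurable x)
    (he : Measurable e) : Measurable fun ω => m (x ω) (e ω) :=
  hm.comp (hx.prodMk he)

lemma measurable_moment_comp {Ω : Type*} [MeasurableSpace Ω] {x : Ω → Obs T L}
    {e : Ω → Latent T L} (hgM : Measurable (Function.uncurry gM)) (hx : Measurable x)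
    (he : Measurable e) : Measurable fun ω => moment gM (x ω) (e ω) :=
  measurable_comp_prodMk (measurable_moment hgM) hx he

lemma slack_self (x : Obs T L) (e : Latent T L) (t : Fin (T + 1)) : slack x e t t = 0 := by
  simp [slack]

/-! ### Centered moments and approximate rationalization -/

variable {Ω : Type*} [MeasurableSpace Ω] {P : Measure Ω} [IsProbabilityMeasure P]
  {x : Ω → Obs T L}

lemma integrable_moment_iff {e : Ω → Latent T L} (hx : Measurable x) (he : Measurable e) :
    Integrable (fun ω => moment gM (x ω) (e ω)) P ↔ Integrable (fun ω => gM (x ω) (e ω)) P := by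
  rw [integrable_piLp_iff, integrable_piLp_iff]
  refine ⟨fun h i => h (Sum.inr i), fun h => ?_⟩
  rintro (p | i)
  · have hs : Measurable fun ω => slack (x ω) (e ω) p.1.1 p.1.2 :=
      (measurable_slack p.1.1 p.1.2).comp (hx.prodMk he)
    refine Integrable.of_bound (C := 1) (Measurable.aestronglyMeasurable ?_)
      (ae_of_all _ fun ω => ?_)
    · exact (Measurable.ite (measurableSet_le measurable_const hs)
        measurable_const measurable_const).sub_const 1
    · change ‖(if 0 ≤ slack (x ω) (e ω) p.1.1 p.1.2 then (1 : ℝ) else 0) - 1‖ ≤ 1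
      split_ifs <;> simp
  · exact h i

lemma integral_moment_inl {e : Ω → Latent T L} (hx : Measurable x) (he : Measurable e)
    (hint : Integrable (fun ω => moment gM (x ω) (e ω)) P)
    (p : {p : Fin (T + 1) × Fin (T + 1) // p.1 ≠ p.2}) :
    (∫ ω, moment gM (x ω) (e ω) ∂P) (Sum.inl p) =
      P.real {ω | 0 ≤ slack (x ω) (e ω) p.1.1 p.1.2} - 1 := by
  have hs : MeasurableSet {ω | 0 ≤ slack (x ω) (e ω) p.1.1 p.1.2} :=
    measurableSet_le measurable_const ((measurable_slack p.1.1 p.1.2).comp (hx.prodMk he))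
  rw [eval_integral_piLp fun i => hint.eval_piLp i]
  have hind : ∀ ω, moment gM (x ω) (e ω) (Sum.inl p) =
      {ω | 0 ≤ slack (x ω) (e ω) p.1.1 p.1.2}.indicator (fun _ => (1 : ℝ)) ω - 1 := by
    intro ω
    simp [moment, Set.indicator_apply]
  simp only [hind]
  rw [integral_sub ((integrable_const 1).indicator hs) (integrable_const 1),
    integral_indicator_const _ hs]
  simp

lemma tendsto_euclidean_iff {ι : Type*} [Fintype ι] {u : ℕ → EuclideanSpace ℝ ι}
    {a : EuclideanSpace ℝ ι} :
    Tendsto u atTop (𝓝 a) ↔ ∀ i, Tendsto (fun j => u j i) atTop (𝓝 (a i)) := by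
  rw [(PiLp.homeomorph 2 fun _ : ι => ℝ).isInducing.tendsto_nhds_iff, tendsto_pi_nhds]
  rfl

/-- The rationalization conditions on a sequence of latent vectors say that the expected moments
exist and tend to zero. The inequalities with `t = s` hold trivially and carry no moment. -/
lemma rationalization_conditions_iff {e : ℕ → Ω → Latent T L} (hx : Measurable x)
    (he : ∀ j, Measurable (e j)) :
    ((∀ t s, Tendsto (fun j => P {ω | 0 ≤ slack (x ω) (e j ω) t s}) atTop (𝓝 1)) ∧
      (∀ j, Integrable (fun ω => gM (x ω) (e j ω)) P) ∧
      Tendsto (fun j => ∫ ω, gM (x ω) (e j ω) ∂P) atTop (𝓝 0)) ↔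
    (∀ j, Integrable (fun ω => moment gM (x ω) (e j ω)) P) ∧
      Tendsto (fun j => ∫ ω, moment gM (x ω) (e j ω) ∂P) atTop (𝓝 0) := by
  have hreal : ∀ t s, Tendsto (fun j => P {ω | 0 ≤ slack (x ω) (e j ω) t s}) atTop (𝓝 1) ↔
      Tendsto (fun j => P.real {ω | 0 ≤ slack (x ω) (e j ω) t s} - 1) atTop (𝓝 0) := by
    intro t s
    rw [← ENNReal.tendsto_toReal_iff (fun j => measure_ne_top P _) ENNReal.one_ne_top,
      ← tendsto_sub_nhds_zero_iff]
    rfl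
  have hinr : ∀ j, Integrable (fun ω => gM (x ω) (e j ω)) P → ∀ i,
      (∫ ω, moment gM (x ω) (e j ω) ∂P) (Sum.inr i) = (∫ ω, gM (x ω) (e j ω) ∂P) i := by
    intro j hj i
    rw [eval_integral_piLp fun i => hj.eval_piLp i, eval_integral_piLp fun i =>
      ((integrable_moment_iff hx (he j)).2 hj).eval_piLp i]
    rfl
  constructor
  · rintro ⟨hs, hint, hlim⟩
    have hint' := fun j => (integrable_moment_iff hx (he j)).2 (hint j)
    refine ⟨hint', tendsto_euclidean_iff.2 ?_⟩
    rintro (p | i)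
    · simp only [fun j => integral_moment_inl hx (he j) (hint' j) p]
      exact (hreal _ _).1 (hs _ _)
    · simp only [fun j => hinr j (hint j) i]
      exact tendsto_euclidean_iff.1 hlim i
  · rintro ⟨hint', hlim⟩
    have hint := fun j => (integrable_moment_iff hx (he j)).1 (hint' j)
    refine ⟨fun t s => ?_, hint, tendsto_euclidean_iff.2 fun i => ?_⟩
    · by_cases hts : t = s
      · subst hts
        simp [slack_self]
      · have := tendsto_euclidean_iff.1 hlim (Sum.inl ⟨(t, s), hts⟩)
        simp only [fun j => integral_moment_inl hx (he j) (hint' j) ⟨(t, s), hts⟩] at this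
        exact (hreal t s).2 this
    · have := tendsto_euclidean_iff.1 hlim (Sum.inr i)
      simp only [fun j => hinr j (hint j) i] at this
      exact this

end Moments

/-! ### The maximum-entropy moment -/

section MaxEnt

variable {T L q : ℕ} {gM : Obs T L → Latent T L → EuclideanSpace ℝ (Fin q)}
  {π₀ : Measure (Obs T L)} {η : Kernel (Obs T L) (Latent T L)}

lemma maxEntMoment_eq_integral_tilted (x : Obs T L) (γ : EuclideanSpace ℝ (MomentIdx T q)) :
    maxEntMoment gM η x γ =
      ∫ e, moment gM x e ∂((η x).tilted fun e => inner ℝ γ (moment gM x e)) := by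
  rw [integral_tilted, maxEntMoment, expMass, ← integral_smul]
  simp only [smul_smul, div_eq_inv_mul]

variable [IsMarkovKernel η] [IsProbabilityMeasure π₀]

lemma measurable_exp_inner_moment (hgM : Measurable (Function.uncurry gM))
    (γ : EuclideanSpace ℝ (MomentIdx T q)) :
    Measurable fun p : Obs T L × Latent T L => Real.exp (inner ℝ γ (moment gM p.1 p.2)) := by
  have := measurable_moment hgM
  fun_prop

lemma measurable_expMass (hgM : Measurable (Function.uncurry gM))
    (γ : EuclideanSpace ℝ (MomentIdx T q)) : Measurable (expMass gM η γ) :=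
  (StronglyMeasurable.integral_kernel_prod_right
    (f := fun x e => Real.exp (inner ℝ γ (moment gM x e)))
    (measurable_exp_inner_moment hgM γ).stronglyMeasurable).measurable

lemma measurable_maxEntMoment (hgM : Measurable (Function.uncurry gM))
    (γ : EuclideanSpace ℝ (MomentIdx T q)) : Measurable fun x => maxEntMoment gM η x γ := by
  unfold maxEntMoment
  refine (measurable_expMass hgM γ).inv.smul (StronglyMeasurable.measurable ?_)
  refine StronglyMeasurable.integral_kernel_prod_right
    (f := fun x e => Real.exp (inner ℝ γ (moment gM x e)) • moment gM x e) ?_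
  exact ((measurable_exp_inner_moment hgM γ).smul (measurable_moment hgM)).stronglyMeasurable

/-- Under the tilted conditional laws the moments have first absolute moments with a
`π₀`-integrable bound: only the *logarithms* of the exponential masses are assumed integrable. -/
lemma exists_integrable_bound_tilted (hgM : Measurable (Function.uncurry gM))
    (hreg : RegularLogMass gM π₀ η) (γ : EuclideanSpace ℝ (MomentIdx T q)) :
    ∃ B : Obs T L → ℝ, Integrable B π₀ ∧ ∀ᵐ x ∂π₀,
      Integrable (moment gM x) ((η x).tilted fun e => inner ℝ γ (moment gM x e)) ∧
      ∫ e, ‖moment gM x e‖ ∂((η x).tilted fun e => inner ℝ γ (moment gM x e)) ≤ B x := by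
  classical
  have hexp := fun γ' => (hreg.1 γ').1
  have hlog := fun γ' => (hreg.1 γ').2
  refine ⟨fun x => ∑ i, (Real.log 2 +
    |Real.log (expMass gM η (γ + EuclideanSpace.single i 1) x) -
      Real.log (expMass gM η γ x)| +
    |Real.log (expMass gM η (γ - EuclideanSpace.single i 1) x) -
      Real.log (expMass gM η γ x)|), ?_, ?_⟩
  · exact integrable_finsetSum _ fun i _ => ((integrable_const _).add
      ((hlog _).sub (hlog γ)).abs).add ((hlog _).sub (hlog γ)).abs
  · filter_upwards [hexp γ, ae_all_iff.2 fun i => hexp (γ + EuclideanSpace.single i 1),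
      ae_all_iff.2 fun i => hexp (γ - EuclideanSpace.single i 1)] with x h0 hadd hsub
    exact integral_norm_tilted_le ((measurable_moment hgM).comp measurable_prodMk_left) h0 hadd
      hsub

lemma integrable_maxEntMoment (hgM : Measurable (Function.uncurry gM))
    (hreg : RegularLogMass gM π₀ η) (γ : EuclideanSpace ℝ (MomentIdx T q)) :
    Integrable (fun x => maxEntMoment gM η x γ) π₀ := by
  obtain ⟨B, hB, hle⟩ := exists_integrable_bound_tilted hgM hreg γ
  refine hB.mono' (measurable_maxEntMoment hgM γ).aestronglyMeasurable ?_
  filter_upwards [hle] with x hx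
  rw [maxEntMoment_eq_integral_tilted]
  exact (norm_integral_le_integral_norm _).trans hx.2

lemma ae_log_expMass_add_inner_le (hgM : Measurable (Function.uncurry gM))
    (hreg : RegularLogMass gM π₀ η) (γ γ' : EuclideanSpace ℝ (MomentIdx T q)) :
    ∀ᵐ x ∂π₀, Real.log (expMass gM η γ x) + inner ℝ (γ' - γ) (maxEntMoment gM η x γ) ≤
      Real.log (expMass gM η γ' x) := by
  obtain ⟨B, -, hle⟩ := exists_integrable_bound_tilted hgM hreg γ
  filter_upwards [hle, (hreg.1 γ).1, (hreg.1 γ').1] with x hx h h'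
  rw [maxEntMoment_eq_integral_tilted]
  exact log_integral_exp_add_inner_le h h' hx.1

/-- The expected maximum-entropy moment is a subgradient of the expected log mass. -/
lemma integral_log_expMass_add_inner_le (hgM : Measurable (Function.uncurry gM))
    (hreg : RegularLogMass gM π₀ η) (γ γ' : EuclideanSpace ℝ (MomentIdx T q)) :
    ∫ x, Real.log (expMass gM η γ x) ∂π₀ +
        inner ℝ (γ' - γ) (∫ x, maxEntMoment gM η x γ ∂π₀) ≤
      ∫ x, Real.log (expMass gM η γ' x) ∂π₀ := by
  have hh := integrable_maxEntMoment hgM hreg γ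
  rw [← integral_inner hh, ← integral_add (hreg.1 γ).2 (hh.const_inner _)]
  exact integral_mono_ae ((hreg.1 γ).2.add (hh.const_inner _)) (hreg.1 γ').2
    (ae_log_expMass_add_inner_le hgM hreg γ γ')

end MaxEnt

section Equivalence

variable {T L q : ℕ} {gM : Obs T L → Latent T L → EuclideanSpace ℝ (Fin q)}
  {π₀ : Measure (Obs T L)} {η : Kernel (Obs T L) (Latent T L)}
  [IsMarkovKernel η] {E : Obs T L → Set (Latent T L)}

/-! ### From small expected moments to rationalizing latent vectors -/

/-- The tilted conditional laws form a Markov kernel, after replacing them by `η` on the `π₀`-null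
set of `x` where the exponential mass is infinite. -/
lemma exists_markovKernel_ae_eq_tilted (hgM : Measurable (Function.uncurry gM))
    (hreg : RegularLogMass gM π₀ η) (γ : EuclideanSpace ℝ (MomentIdx T q)) :
    ∃ κ : Kernel (Obs T L) (Latent T L), IsMarkovKernel κ ∧
      ∀ᵐ x ∂π₀, κ x = (η x).tilted fun e => inner ℝ γ (moment gM x e) := by
  have hdens : Measurable (Function.uncurry fun (x : Obs T L) (e : Latent T L) =>
      ENNReal.ofReal (Real.exp (inner ℝ γ (moment gM x e)) / expMass gM η γ x)) :=
    ((measurable_exp_inner_moment hgM γ).div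
      ((measurable_expMass hgM γ).comp measurable_fst)).ennreal_ofReal
  set κ₀ : Kernel (Obs T L) (Latent T L) := η.withDensity fun x e =>
    ENNReal.ofReal (Real.exp (inner ℝ γ (moment gM x e)) / expMass gM η γ x) with hκ₀
  have hκ₀_apply : ∀ x, κ₀ x = (η x).tilted fun e => inner ℝ γ (moment gM x e) := fun x =>
    Kernel.withDensity_apply η hdens x
  have hS : MeasurableSet {x | κ₀ x Set.univ = 1} :=
    measurableSet_eq_fun (κ₀.measurable_coe MeasurableSet.univ) measurable_const
  classical
  refine ⟨Kernel.piecewise hS κ₀ η, ⟨fun x => ⟨?_⟩⟩, ?_⟩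
  · rw [Kernel.piecewise_apply]
    split_ifs with h
    · exact h
    · exact measure_univ
  · filter_upwards [(hreg.1 γ).1] with x hx
    have : IsProbabilityMeasure ((η x).tilted fun e => inner ℝ γ (moment gM x e)) :=
      isProbabilityMeasure_tilted hx
    have hxS : x ∈ {x | κ₀ x Set.univ = 1} := by
      change κ₀ x Set.univ = 1
      rw [hκ₀_apply]
      exact measure_univ
    rw [Kernel.piecewise_apply, if_pos hxS, hκ₀_apply]

variable [IsProbabilityMeasure π₀]

/-- Latent vectors drawn from the maximum-entropy laws are supported in `E` and realize the
expected maximum-entropy moments. -/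
lemma exists_random_latent (hEmeas : MeasurableSet {p : Obs T L × Latent T L | p.2 ∈ E p.1})
    (hgM : Measurable (Function.uncurry gM)) (hsupp : SupportedOn E gM π₀ η)
    (hreg : RegularLogMass gM π₀ η) (γ : EuclideanSpace ℝ (MomentIdx T q)) :
    ∃ f : Obs T L × unitInterval → Latent T L, Measurable f ∧
      (∀ᵐ ω ∂π₀.prod volume, f ω ∈ E ω.1) ∧
      Integrable (fun ω => moment gM ω.1 (f ω)) (π₀.prod volume) ∧
      ∫ ω, moment gM ω.1 (f ω) ∂π₀.prod volume = ∫ x, maxEntMoment gM η x γ ∂π₀ := by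
  obtain ⟨κ, hκ, hκη⟩ := exists_markovKernel_ae_eq_tilted hgM hreg γ
  have : StandardBorelSpace (Latent T L) := by
    have : StandardBorelSpace (Obs T L) := StandardBorelSpace.pi_countable
    infer_instance
  obtain ⟨f, hf, hfκ⟩ := κ.exists_measurable_map_eq_unitInterval
  have hpair : Measurable fun ω : Obs T L × unitInterval => (ω.1, Function.uncurry f ω) :=
    measurable_fst.prodMk hf
  have hmap : (π₀.prod volume).map (fun ω => (ω.1, Function.uncurry f ω)) = π₀ ⊗ₘ κ := by
    ext s hs
    rw [Measure.map_apply hpair hs, Measure.prod_apply (hpair hs), Measure.compProd_apply hs]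
    refine lintegral_congr fun x => ?_
    rw [← hfκ, Measure.map_apply hf.of_uncurry_left (measurable_prodMk_left hs)]
    rfl
  have hm := measurable_moment hgM
  have hint : Integrable (fun p : Obs T L × Latent T L => moment gM p.1 p.2) (π₀ ⊗ₘ κ) := by
    obtain ⟨B, hB, hle⟩ := exists_integrable_bound_tilted hgM hreg γ
    refine (Measure.integrable_compProd_iff hm.aestronglyMeasurable).2 ⟨?_, ?_⟩
    · filter_upwards [hκη, hle] with x hx hx'
      rw [hx]
      exact hx'.1
    · refine hB.mono' (StronglyMeasurable.integral_kernel_prod_right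
        (f := fun x e => ‖moment gM x e‖) hm.norm.stronglyMeasurable).aestronglyMeasurable ?_
      filter_upwards [hκη, hle] with x hx hx'
      rw [hx, Real.norm_of_nonneg (integral_nonneg fun _ => norm_nonneg _)]
      exact hx'.2
  refine ⟨Function.uncurry f, hf, ?_, ?_, ?_⟩
  · have h : ∀ᵐ p ∂(π₀ ⊗ₘ κ), p.2 ∈ E p.1 := by
      refine (Measure.ae_compProd_iff hEmeas).2 ?_
      filter_upwards [hκη, hsupp] with x hx hx'
      rw [hx]
      exact (tilted_absolutelyContinuous _ _).ae_le hx'.1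
    rw [← hmap] at h
    exact ae_of_ae_map hpair.aemeasurable h
  · rw [← hmap] at hint
    exact hint.comp_measurable hpair
  · calc ∫ ω, moment gM ω.1 (Function.uncurry f ω) ∂π₀.prod volume
        = ∫ p, moment gM p.1 p.2 ∂(π₀ ⊗ₘ κ) := by
          rw [← hmap, integral_map hpair.aemeasurable hm.aestronglyMeasurable]
      _ = ∫ x, ∫ e, moment gM x e ∂κ x ∂π₀ := Measure.integral_compProd hint
      _ = ∫ x, maxEntMoment gM η x γ ∂π₀ := by
          refine integral_congr_ae ?_
          filter_upwards [hκη] with x hx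
          rw [hx, maxEntMoment_eq_integral_tilted]

lemma approxRationalizable_of_iInf_eq_zero
    (hEmeas : MeasurableSet {p : Obs T L × Latent T L | p.2 ∈ E p.1})
    (hgM : Measurable (Function.uncurry gM)) (hsupp : SupportedOn E gM π₀ η)
    (hreg : RegularLogMass gM π₀ η)
    (hinf : (⨅ γ : EuclideanSpace ℝ (MomentIdx T q), ‖∫ x, maxEntMoment gM η x γ ∂π₀‖) = 0) :
    ApproxRationalizable E gM π₀ := by
  have hγ : ∀ j : ℕ, ∃ γ : EuclideanSpace ℝ (MomentIdx T q),
      ‖∫ x, maxEntMoment gM η x γ ∂π₀‖ < 1 / ((j : ℝ) + 1) := fun j =>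
    exists_lt_of_ciInf_lt (hinf.trans_lt Nat.one_div_pos_of_nat)
  choose γ hγ using hγ
  choose f hf hfE hfint hfeq using fun j => exists_random_latent hEmeas hgM hsupp hreg (γ j)
  refine ⟨Obs T L × unitInterval, inferInstance, π₀.prod volume, Prod.fst, f, inferInstance,
    measurable_fst, ?_, hf, hfE, (rationalization_conditions_iff measurable_fst hf).2
      ⟨hfint, ?_⟩⟩
  · exact Measure.map_fst_prod.trans (by simp)
  · refine squeeze_zero_norm (fun j => ?_) tendsto_one_div_add_atTop_nhds_zero_nat
    rw [hfeq]
    exact (hγ j).le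

/-! ### From rationalizing latent vectors to small expected moments -/

/-- Any latent vector supported in `E` bounds the expected log mass from below by an almost linear
function whose slope is its expected moment. Near the moment `Y` of the latent vector, `η` has
positive mass, but this mass may have no integrable logarithm; so `Y` is replaced by the
maximum-entropy moment `h(x;0)` on the unlikely event that the mass falls below a threshold, where
Jensen's inequality gives the bound with no loss. -/
lemma exists_lower_bound_of_random_latent {Ω : Type*} [MeasurableSpace Ω] {P : Measure Ω}
    [IsProbabilityMeasure P] {x : Ω → Obs T L} {e : Ω → Latent T L}
    (hgM : Measurable (Function.uncurry gM)) (hsupp : SupportedOn E gM π₀ η)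
    (hreg : RegularLogMass gM π₀ η) (hx : Measurable x) (hlaw : P.map x = π₀)
    (he : Measurable e) (heE : ∀ᵐ ω ∂P, e ω ∈ E (x ω))
    (hY : Integrable (fun ω => moment gM (x ω) (e ω)) P) {ε : ℝ} (hε : 0 < ε) :
    ∃ C : ℝ, ∀ γ : EuclideanSpace ℝ (MomentIdx T q),
      inner ℝ γ (∫ ω, moment gM (x ω) (e ω) ∂P) - 2 * ε * ‖γ‖ - C ≤
        ∫ x, Real.log (expMass gM η γ x) ∂π₀ := by
  set Y : Ω → EuclideanSpace ℝ (MomentIdx T q) := fun ω => moment gM (x ω) (e ω) with hYdef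
  have hm := measurable_moment hgM
  have hYm : Measurable Y := measurable_moment_comp hgM hx he
  clear_value Y
  set p : Ω → ENNReal := fun ω => η (x ω) {e' | ‖moment gM (x ω) e' - Y ω‖ < ε} with hp
  have hpm : Measurable p := by
    have hset : MeasurableSet {z : Ω × Latent T L | ‖moment gM (x z.1) z.2 - Y z.1‖ < ε} :=
      measurableSet_lt ((measurable_moment_comp hgM (hx.comp measurable_fst)
        measurable_snd).sub (hYm.comp measurable_fst)).norm measurable_const
    exact Kernel.measurable_kernel_prodMk_left (κ := η.comap x hx) hset
  have hae : ∀ {Q : Obs T L → Prop}, (∀ᵐ y ∂π₀, Q y) → ∀ᵐ ω ∂P, Q (x ω) := by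
    intro Q hQ
    rw [← hlaw] at hQ
    exact ae_of_ae_map hx.aemeasurable hQ
  have hppos : ∀ᵐ ω ∂P, 0 < p ω := by
    filter_upwards [hae hsupp, heE] with ω hω hωE
    have hpω := hω.2 (e ω) hωE ε hε
    rw [← congrFun hYdef ω] at hpω
    exact hpω.trans_le (measure_mono fun _ h => h.2)
  set H : Ω → EuclideanSpace ℝ (MomentIdx T q) := fun ω => maxEntMoment gM η (x ω) 0 with hH
  have hHint : Integrable H P := by
    have h := integrable_maxEntMoment hgM hreg 0
    rw [← hlaw] at h
    exact h.comp_measurable hx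
  classical
  set W : ℕ → Ω → EuclideanSpace ℝ (MomentIdx T q) := fun n =>
    {ω | ((n : ENNReal) + 1)⁻¹ ≤ p ω}.piecewise Y H with hW
  obtain ⟨hWint, hWlim⟩ : (∀ n, Integrable (W n) P) ∧
      Tendsto (fun n => ∫ ω, W n ω ∂P) atTop (𝓝 (∫ ω, Y ω ∂P)) :=
    tendsto_integral_piecewise_of_pos hY hHint hpm hppos
  obtain ⟨n, hn⟩ := (hWlim.eventually (Metric.ball_mem_nhds _ hε)).exists
  replace hn : ‖∫ ω, W n ω ∂P - ∫ ω, Y ω ∂P‖ < ε := by simpa [dist_eq_norm] using hn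
  refine ⟨Real.log (n + 1), fun γ => ?_⟩
  have hpoint : ∀ᵐ ω ∂P, inner ℝ γ (W n ω) - (ε * ‖γ‖ + Real.log (n + 1)) ≤
      Real.log (expMass gM η γ (x ω)) := by
    filter_upwards [hae (hreg.1 γ).1, hae (ae_log_expMass_add_inner_le hgM hreg 0 γ)]
      with ω hexp hzero
    by_cases h : ω ∈ {ω | ((n : ENNReal) + 1)⁻¹ ≤ p ω}
    · have hWω : W n ω = Y ω := Set.piecewise_eq_of_mem _ _ _ h
      have hnp : ((n : ℝ) + 1)⁻¹ ≤ (η (x ω)).real {e' | ‖moment gM (x ω) e' - Y ω‖ < ε} := by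
        have h' := ENNReal.toReal_mono (measure_ne_top _ _) (show _ ≤ η (x ω) _ from h)
        rw [ENNReal.toReal_inv] at h'
        exact_mod_cast h'
      have hlog := inner_sub_add_log_le_log_integral_exp (hm.comp measurable_prodMk_left)
        (by positivity) hnp hexp
      rw [Real.log_inv] at hlog
      rw [hWω]
      exact (show _ = _ by ring).trans_le hlog
    · have hWω : W n ω = H ω := Set.piecewise_eq_of_notMem _ _ _ h
      rw [hWω]
      have h0 : expMass gM η 0 (x ω) = 1 := by simp [expMass]
      rw [h0, Real.log_one, sub_zero, zero_add] at hzero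
      have h1 : 0 ≤ Real.log ((n : ℝ) + 1) := Real.log_nonneg (by linarith [n.cast_nonneg (α := ℝ)])
      have h2 : 0 ≤ ε * ‖γ‖ := by positivity
      linarith
  have hlogint : Integrable (fun ω => Real.log (expMass gM η γ (x ω))) P := by
    have h := (hreg.1 γ).2
    rw [← hlaw] at h
    exact h.comp_measurable hx
  have hmono := integral_mono_ae (((hWint n).const_inner γ).sub (integrable_const _)) hlogint hpoint
  have hleft : ∫ ω, (inner ℝ γ (W n ω) - (ε * ‖γ‖ + Real.log (n + 1))) ∂P =
      inner ℝ γ (∫ ω, W n ω ∂P) - (ε * ‖γ‖ + Real.log (n + 1)) := by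
    rw [integral_sub ((hWint n).const_inner γ) (integrable_const _), integral_inner (hWint n)]
    simp
  have hright : ∫ ω, Real.log (expMass gM η γ (x ω)) ∂P =
      ∫ y, Real.log (expMass gM η γ y) ∂π₀ := by
    have hmeas : Measurable fun y => Real.log (expMass gM η γ y) :=
      Real.measurable_log.comp (measurable_expMass hgM γ)
    rw [← hlaw, integral_map hx.aemeasurable hmeas.aestronglyMeasurable]
  have hmono' : inner ℝ γ (∫ ω, W n ω ∂P) - (ε * ‖γ‖ + Real.log (n + 1)) ≤
      ∫ y, Real.log (expMass gM η γ y) ∂π₀ := by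
    rw [← hleft, ← hright]
    exact hmono
  have hdiff := (abs_le.1 (abs_real_inner_le_norm γ (∫ ω, W n ω ∂P - ∫ ω, Y ω ∂P))).1
  have hsmall : ‖γ‖ * ‖∫ ω, W n ω ∂P - ∫ ω, Y ω ∂P‖ ≤ ‖γ‖ * ε := by gcongr
  rw [inner_sub_right] at hdiff
  linarith

lemma iInf_eq_zero_of_approxRationalizable (hgM : Measurable (Function.uncurry gM))
    (hsupp : SupportedOn E gM π₀ η) (hreg : RegularLogMass gM π₀ η)
    (h : ApproxRationalizable E gM π₀) :
    (⨅ γ : EuclideanSpace ℝ (MomentIdx T q), ‖∫ x, maxEntMoment gM η x γ ∂π₀‖) = 0 := by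
  obtain ⟨Ω, _, P, x, e, _, hx, hlaw, he, heE, hcond⟩ := h
  obtain ⟨hint, hlim⟩ := (rationalization_conditions_iff hx he).1 hcond
  refine le_antisymm (le_of_forall_pos_le_add fun ε hε => ?_)
    (Real.iInf_nonneg fun _ => norm_nonneg _)
  obtain ⟨j, hj⟩ := (hlim.eventually (Metric.ball_mem_nhds _ (by positivity : 0 < ε / 4))).exists
  replace hj : ‖∫ ω, moment gM (x ω) (e j ω) ∂P‖ < ε / 4 := by simpa using hj
  -- the slope `ε / 4` of the expected moment plus twice the radius `ε / 8` stays below `ε`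
  obtain ⟨C, hC⟩ := exists_lower_bound_of_random_latent hgM hsupp hreg hx hlaw (he j) (heE j)
    (hint j) (by positivity : 0 < ε / 8)
  obtain ⟨γ, hγ⟩ := exists_norm_subgradient_le (c := ε / 2) (c' := ε) (C := C)
    (hreg.2.differentiable two_ne_zero) (integral_log_expMass_add_inner_le hgM hreg)
    (by positivity) (by linarith) fun γ => by
      have h1 := (abs_le.1 (abs_real_inner_le_norm γ (∫ ω, moment gM (x ω) (e j ω) ∂P))).1
      have h2 : ‖γ‖ * ‖∫ ω, moment gM (x ω) (e j ω) ∂P‖ ≤ ‖γ‖ * (ε / 4) := by gcongr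
      linarith [hC γ]
  rw [zero_add]
  exact (ciInf_le ⟨0, Set.forall_mem_range.2 fun _ => norm_nonneg _⟩ γ).trans hγ

end Equivalence

end RevealedPreference

theorem theorem3 (T L q : ℕ)
    -- the model: supports of the marginal utility of income and of the discount rate
    (Λ Δ : Set (Fin (T + 1) → ℝ))
    (hΛ : ∀ lam ∈ Λ, ∀ t, 0 < lam t)
    (hΔ : ∀ del ∈ Δ, ∀ t, 0 < del t ∧ del t ≤ 1)
    -- the known conditional support of the latent vector
    (E : RevealedPreference.Obs T L → Set (RevealedPreference.Latent T L))
    (hE : ∀ x, E x ⊆ RevealedPreference.admissible Λ Δ x)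
    (hEmeas : MeasurableSet
      {p : RevealedPreference.Obs T L × RevealedPreference.Latent T L | p.2 ∈ E p.1})
    -- the measurement error moment
    (gM : RevealedPreference.Obs T L → RevealedPreference.Latent T L →
      EuclideanSpace ℝ (Fin q))
    (hgM : Measurable (Function.uncurry gM))
    -- the distribution of the observed array
    (π₀ : MeasureTheory.Measure (RevealedPreference.Obs T L))
    [MeasureTheory.IsProbabilityMeasure π₀]
    -- the user-specified conditional distribution
    (η : ProbabilityTheory.Kernel (RevealedPreference.Obs T L) (RevealedPreference.Latent T L))
    [ProbabilityTheory.IsMarkovKernel η]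
    (hηsupp : RevealedPreference.SupportedOn E gM π₀ η)
    (hηreg : RevealedPreference.RegularLogMass gM π₀ η) :
    RevealedPreference.ApproxRationalizable E gM π₀ ↔
      (⨅ γ : EuclideanSpace ℝ (RevealedPreference.MomentIdx T q),
        ‖∫ x, RevealedPreference.maxEntMoment gM η x γ ∂π₀‖) = 0 := by
  exact ⟨RevealedPreference.iInf_eq_zero_of_approxRationalizable hgM hηsupp hηreg,
    RevealedPreference.approxRationalizable_of_iInf_eq_zero hEmeas hgM hηsupp hηreg⟩
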